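/- All Markov decision processes (MDPs) here are stationary and tabular: finite state set $\mathcal S$, finite action set $\mathcal A$, transition function $P(\cdot\mid s,a)$, and reward function $r:\mathcal S\times\mathcal A\to[0,1]$. The \emph{diameter} of an MDP is $\max_{s,s'\in\mathcal S}\min_{\pi}\mathbb E[T^{\pi}_{s,s'}]$, where $\pi$ ranges over stationary policies $\mathcal S\to\mathcal A$ and $T^{\pi}_{s,s'}=\inf\{t>0: s_t=s'\}$ is the first passage time of the Markov chain induced by $\pi$ and started at $s_0=s$. A family $m_1,\dots,m_M$ of MDPs with common $\mathcal S,\mathcal A,r$ and transition functions $P_1,\dots,P_M$ is \emph{$\lambda$-separable} if for all $i\ne j$ there is $(s,a)\in\mathcal S\times\mathcal A$ with $\|P_i(\cdot\mid s,a)-P_j(\cdot\mid s,a)\|_1\ge\lambda$. It is \emph{PAC-identifiable} if there are a function $f:(0,1)\to\mathbb N$, a history-dependent policy $\pi$ and a classification algorithm $\mathcal C$ (a possibly randomized map from finite sequences of state-transition samples $(s,a,s')$ to $\{1,\dots,M\}$) such that for every $p\in(0,1)$, every $i$ and every initial state, if $\pi$ is run on $m_i$ for $f(p)$ steps and the observed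 transitions are given to $\mathcal C$, then $\mathcal C$ outputs $i$ with probability at least $1-p$. \textbf{Lemma.} Let $S,A\ge 20$ be integers, let $D\ge 16$ be real with $\log_{A/2}(S/3)\le D/2$, and let $\lambda\in(0,\tfrac12]$. There exists a PAC-identifiable, $\lambda$-separable family of $M=\lfloor SA/12\rfloor$ MDPs with a common state set of size at most $S$, a common action set of size $A$ and a common reward function, each of diameter at most $D$, with the following property. Let $\mathcal C$ be any (possibly randomized) classification algorithm that is given $n$ state-transition samples with $n<\frac{SA}{180\lambda^2}$. The samples may be collected by any adaptive, possibly randomized, rule that chooses the next state-action pair to sample from the samples seen so far (in particular, by running any history-dependent policy from any initial state). Then there is an $i$ such that, when the samples come from $m_i$, $\mathcal C$ fails to output $i$ with probability at least $\tfrac12$. -/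

import Mathlib

open scoped ENNReal

noncomputable section

namespace MultiTaskRL

/-- A stationary tabular Markov decision process with state set `S` and action set `A`:
`transition s a` is the law `P(· | s, a)` of the next state, `reward s a ∈ [0,1]` is the
deterministic reward. -/
structure MDP (S A : Type) where
  transition : S → A → PMF S
  reward : S → A → ℝ
  reward_mem : ∀ s a, reward s a ∈ Set.Icc (0 : ℝ) 1

/-- A state-transition sample `(s, a, s')`: action `a` in state `s` led to state `s'`. -/
abbrev Sample (S A : Type) : Type := S × A × S

/-- A (possibly randomized) adaptive sampling rule: given the samples seen so far, in order, it
draws the state-action pair at which the next transition is sampled. -/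
abbrev Sampler (S A : Type) : Type := List (Sample S A) → PMF (S × A)

/-- A (possibly randomized) history-dependent policy: given the transitions seen so far, in order,
and the current state, it draws the next action. -/
abbrev Policy (S A : Type) : Type := List (Sample S A) → S → PMF A

/-- A (possibly randomized) classification algorithm for `K` models: given a finite sequence of
state-transition samples, it draws the index of a model. -/
abbrev Classifier (S A : Type) (K : ℕ) : Type := List (Sample S A) → PMF (Fin K)

/-- The current state of a run started in `s₁`, after the transitions `h`. -/
def currentState {S A : Type} (s₁ : S) (h : List (Sample S A)) : S :=
  (h.getLast?).elim s₁ (fun x => x.2.2)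

/-- Running the policy `π` from the initial state `s₁`, as a sampling rule: the state of the next
state-action pair is always the current state of the run. -/
def Policy.run {S A : Type} (π : Policy S A) (s₁ : S) : Sampler S A := fun h =>
  (π h (currentState s₁ h)).map (fun a => (currentState s₁ h, a))

/-- The stationary deterministic policy given by `μ : S → A`. -/
def stationary {S A : Type} (μ : S → A) : Policy S A := fun _ s => PMF.pure (μ s)

namespace MDP

variable {S A : Type}

/-- The law of the first `n` state-transition samples (in order of collection) that the sampling
rule `q` collects on the MDP `m`. -/
def sampleLaw (m : MDP S A) (q : Sampler S A) : ℕ → PMF (List (Sample S A))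
  | 0 => PMF.pure []
  | n + 1 => (m.sampleLaw q n).bind fun h =>
      (q h).bind fun x => (m.transition x.1 x.2).bind fun s' => PMF.pure (h ++ [(x.1, x.2, s')])

/-- The expectation of the first passage time `T = inf {t > 0 | s_t = s'}` of the Markov chain
induced by the stationary policy `μ` on `m` and started in `s_0 = s`, written as
`E[T] = ∑ n, P(T > n)`; the event `T > n` says that none of `s_1, …, s_n` equals `s'`. -/
def expectedPassageTime (m : MDP S A) (μ : S → A) (s s' : S) : ℝ≥0∞ :=
  ∑' n : ℕ, (m.sampleLaw ((stationary μ).run s) n).toOuterMeasure {h | ∀ x ∈ h, x.2.2 ≠ s'}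

/-- The diameter: `max` over pairs of states of the `min` over stationary policies of the expected
first passage time. -/
def diameter (m : MDP S A) : ℝ≥0∞ :=
  ⨆ s : S, ⨆ s' : S, ⨅ μ : S → A, m.expectedPassageTime μ s s'

/-- The law of the output of the classification algorithm `C` when it is given `n` samples that
`q` collects on `m`. -/
def outputLaw {K : ℕ} (m : MDP S A) (q : Sampler S A) (n : ℕ) (C : Classifier S A K) :
    PMF (Fin K) :=
  (m.sampleLaw q n).bind C

end MDP

variable {S A : Type}

/-- The `ℓ¹` distance of two probability mass functions on a finite set. -/
def l1Dist [Fintype S] (p q : PMF S) : ℝ := ∑ s, |(p s).toReal - (q s).toReal|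

/-- The `lam`-distinguishing set of two models. -/
def distinguishingSet [Fintype S] (lam : ℝ) (m m' : MDP S A) : Set (S × A) :=
  {x | lam ≤ l1Dist (m.transition x.1 x.2) (m'.transition x.1 x.2)}

/-- `lam`-separability of a family of models. -/
def IsSeparable [Fintype S] {K : ℕ} (lam : ℝ) (M : Fin K → MDP S A) : Prop :=
  ∀ i j : Fin K, i ≠ j → (distinguishingSet lam (M i) (M j)).Nonempty

/-- PAC identifiability: one sample collection policy and one classification algorithm identify,
for every `p ∈ (0,1)`, each model with probability at least `1 - p` from the samples of a run of
`f p` steps, whatever the initial state of the run. -/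
def IsPACIdentifiable {K : ℕ} (M : Fin K → MDP S A) : Prop :=
  ∃ (f : Set.Ioo (0 : ℝ) 1 → ℕ) (π : Policy S A) (C : Classifier S A K),
    ∀ (p : Set.Ioo (0 : ℝ) 1) (i : Fin K) (s₁ : S),
      1 - (p : ℝ) ≤ ((M i).outputLaw (π.run s₁) (f p) C i).toReal

end MultiTaskRL

end

/-! The hard family hides one slightly biased coin among `K = S * A / 12` coins. In a de Bruijn
graph with about `A / 2` deterministic navigating actions, `K` of the remaining state-action pairs
are arms, each leading to one of two fixed states. All arms are fair except that in model `i` arm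
`i` has probabilities `(1 ± lam) / 2`. Two models differ by exactly `lam` in ℓ¹ distance at an arm,
and navigation without arms joins any two states in exactly `⌊D⌋₊` steps, which bounds the diameter.

Lower bound (`sum_outputLaw_le`): with `L i` the log-likelihood ratio of model `i` against the
all-fair base model, the success probabilities sum to the base expectation of `∑ i, exp (L i) * C h
i`. The inequality `exp t * g ≤ 2 * g + 2 * (exp t - 1 - t)` (`exp_mul_le`) bounds this by 2 plus
twice the sum of the relative entropies of the base law to the biased laws. One sample touches at
most one arm, so it adds at most `2 / 3 * lam ^ 2` to the whole sum, however adaptive the sampling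
rule. If `lam ^ 2 * n` is small compared with `K`, the average success probability is below 1/2.

Identifiability (`isPACIdentifiable`): exact-length walks allow a round-robin schedule that pulls
every arm equally often by design, and Chebyshev's inequality shows that a threshold on the mean
sign finds the biased arm. -/

set_option linter.unusedSectionVars false

noncomputable section

namespace MultiTaskRL

/-! ### Expectations over sampled histories -/

section Expectation

variable {S A : Type} [Fintype S] [Fintype A]

/-- The expectation of `F` of the first `n` samples that `q` collects on `m`. -/
def MDP.expect (m : MDP S A) (q : Sampler S A) : ℕ → (List (Sample S A) → ℝ) → ℝ
  | 0, F => F []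
  | n + 1, F => MDP.expect m q n fun h =>
      ∑ x : S × A, (q h x).toReal *
        ∑ s, (m.transition x.1 x.2 s).toReal * F (h ++ [(x.1, x.2, s)])

theorem pmf_sum_toReal {T : Type} [Fintype T] (p : PMF T) : ∑ x, (p x).toReal = 1 := by
  rw [← ENNReal.toReal_sum (fun x _ => p.apply_ne_top x), ← tsum_fintype (L := .unconditional _),
    p.tsum_coe, ENNReal.toReal_one]

theorem pmf_bind_toReal {T U : Type} [Fintype T] (p : PMF T) (f : T → PMF U) (u : U) :
    (p.bind f u).toReal = ∑ x, (p x).toReal * (f x u).toReal := by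
  rw [PMF.bind_apply, tsum_fintype, ENNReal.toReal_sum]
  · simp [ENNReal.toReal_mul]
  · exact fun x _ => ENNReal.mul_ne_top (p.apply_ne_top x) ((f x).apply_ne_top u)

/-- Histories form an infinite type, but each step has finitely many outcomes. This lets all later
probability estimates use real-valued finite sums. -/
theorem MDP.outputLaw_toReal {K : ℕ} (m : MDP S A) (q : Sampler S A) (n : ℕ)
    (C : Classifier S A K) (i : Fin K) :
    (m.outputLaw q n C i).toReal = m.expect q n fun h => (C h i).toReal := by
  induction n generalizing C with
  | zero => simp [MDP.outputLaw, MDP.sampleLaw, MDP.expect]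
  | succ n ih =>
    have key : m.outputLaw q (n + 1) C = m.outputLaw q n (fun h => (q h).bind fun x =>
        (m.transition x.1 x.2).bind fun s' => C (h ++ [(x.1, x.2, s')])) := by
      simp [MDP.outputLaw, MDP.sampleLaw, PMF.bind_bind]
    rw [key, ih, MDP.expect]
    simp only [pmf_bind_toReal]

variable (m : MDP S A) (q : Sampler S A)

/-- Monotonicity of the expectation, with an invariant of the histories. -/
theorem MDP.expect_mono_of_invariant (I : ℕ → List (Sample S A) → Prop) (h0 : I 0 [])
    (hstep : ∀ n h, I n h → ∀ x s, q h x ≠ 0 → m.transition x.1 x.2 s ≠ 0 →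
      I (n + 1) (h ++ [(x.1, x.2, s)]))
    (n : ℕ) {F G : List (Sample S A) → ℝ} (hFG : ∀ h, I n h → F h ≤ G h) :
    m.expect q n F ≤ m.expect q n G := by
  induction n generalizing F G with
  | zero => exact hFG _ h0
  | succ n ih =>
    refine ih fun h hh => Finset.sum_le_sum fun x _ => ?_
    by_cases hx : q h x = 0
    · simp [hx]
    refine mul_le_mul_of_nonneg_left (Finset.sum_le_sum fun s _ => ?_) ENNReal.toReal_nonneg
    by_cases hs : m.transition x.1 x.2 s = 0
    · simp [hs]
    exact mul_le_mul_of_nonneg_left (hFG _ (hstep n h hh x s hx hs)) ENNReal.toReal_nonneg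

theorem MDP.expect_mono (n : ℕ) {F G : List (Sample S A) → ℝ} (hFG : ∀ h, F h ≤ G h) :
    m.expect q n F ≤ m.expect q n G :=
  m.expect_mono_of_invariant q (fun _ _ => True) trivial (fun _ _ _ _ _ _ _ => trivial) n
    fun h _ => hFG h

theorem MDP.expect_add (n : ℕ) (F G : List (Sample S A) → ℝ) :
    m.expect q n (fun h => F h + G h) = m.expect q n F + m.expect q n G := by
  induction n generalizing F G with
  | zero => rfl
  | succ n ih =>
    simp only [MDP.expect, ← ih]
    simp only [mul_add, Finset.sum_add_distrib]

theorem MDP.expect_const_mul (n : ℕ) (c : ℝ) (F : List (Sample S A) → ℝ) :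
    m.expect q n (fun h => c * F h) = c * m.expect q n F := by
  induction n generalizing F with
  | zero => rfl
  | succ n ih =>
    simp only [MDP.expect, ← ih]
    simp only [Finset.mul_sum, mul_left_comm c]

theorem sum_step_const (p : PMF (S × A)) (P : S → A → PMF S) (c : ℝ) :
    ∑ x : S × A, (p x).toReal * ∑ s, (P x.1 x.2 s).toReal * c = c := by
  simp only [← Finset.sum_mul, pmf_sum_toReal, one_mul]

theorem MDP.expect_const (n : ℕ) (c : ℝ) : m.expect q n (fun _ => c) = c := by
  induction n with
  | zero => rfl
  | succ n ih => simp only [MDP.expect, sum_step_const, ih]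

theorem MDP.expect_sum {ι : Type} (t : Finset ι) (n : ℕ) (F : ι → List (Sample S A) → ℝ) :
    m.expect q n (fun h => ∑ i ∈ t, F i h) = ∑ i ∈ t, m.expect q n (F i) := by
  classical
  induction t using Finset.induction_on with
  | empty => simp [MDP.expect_const]
  | insert i t hi ih => simp only [Finset.sum_insert hi, MDP.expect_add, ih]

/-- If every step raises the conditional expectation of `F` by at least `c`, then `n` steps raise
the expectation by at least `n * c`. -/
theorem MDP.le_expect_of_step {F : List (Sample S A) → ℝ} {c : ℝ}
    (hF : ∀ (h : List (Sample S A)) (x : S × A), F h + c ≤ ∑ s, (m.transition x.1 x.2 s).toReal * F (h ++ [(x.1, x.2, s)]))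
    (n : ℕ) : F [] + n * c ≤ m.expect q n F := by
  induction n with
  | zero => simp [MDP.expect]
  | succ n ih =>
    have h1 : m.expect q n (fun h => F h + c) ≤ m.expect q (n + 1) F := by
      refine m.expect_mono q n fun h => ?_
      calc F h + c = ∑ x : S × A, (q h x).toReal * (F h + c) := by
            rw [← Finset.sum_mul, pmf_sum_toReal, one_mul]
        _ ≤ _ := Finset.sum_le_sum fun x _ =>
            mul_le_mul_of_nonneg_left (hF h x) ENNReal.toReal_nonneg
    rw [MDP.expect_add, MDP.expect_const] at h1
    push_cast
    linarith

/-- Change of measure along a multiplicative likelihood ratio. -/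
theorem MDP.expect_change (m' : MDP S A) {W : List (Sample S A) → ℝ} (hW0 : W [] = 1)
    (hW : ∀ (h : List (Sample S A)) (x : S × A) s, (m.transition x.1 x.2 s).toReal * W (h ++ [(x.1, x.2, s)]) =
      W h * (m'.transition x.1 x.2 s).toReal)
    (n : ℕ) (F : List (Sample S A) → ℝ) :
    m'.expect q n F = m.expect q n (fun h => W h * F h) := by
  induction n generalizing F with
  | zero => simp [MDP.expect, hW0]
  | succ n ih =>
    simp only [MDP.expect, ih]
    congr 1
    funext h
    rw [Finset.mul_sum]
    refine Finset.sum_congr rfl fun x _ => ?_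
    rw [mul_left_comm, Finset.mul_sum]
    congr 1
    refine Finset.sum_congr rfl fun s _ => ?_
    rw [← mul_assoc, ← hW, mul_assoc]

end Expectation

theorem MDP.support_invariant {S A : Type} (m : MDP S A) (q : Sampler S A)
    (I : ℕ → List (Sample S A) → Prop) (h0 : I 0 [])
    (hstep : ∀ n h, I n h → ∀ x s, x ∈ (q h).support → s ∈ (m.transition x.1 x.2).support →
      I (n + 1) (h ++ [(x.1, x.2, s)]))
    (n : ℕ) : ∀ h ∈ (m.sampleLaw q n).support, I n h := by
  induction n with
  | zero => simpa [MDP.sampleLaw] using h0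
  | succ n ih =>
    intro h hh
    simp only [MDP.sampleLaw, PMF.mem_support_bind_iff, PMF.support_pure,
      Set.mem_singleton_iff] at hh
    obtain ⟨g, hg, x, hx, s, hs, rfl⟩ := hh
    exact hstep n g (ih g hg) x s hx hs

theorem currentState_append {S A : Type} (s₁ : S) (h : List (Sample S A)) (z : Sample S A) :
    currentState s₁ (h ++ [z]) = z.2.2 := by
  simp [currentState]

/-! ### Biased coins and arm systems -/

section Coin

variable {S : Type} [Fintype S] [DecidableEq S]

/-- The law on `{x₀, x₁}` with probabilities `(1 + θ) / 2` and `(1 - θ) / 2`. -/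
def coin (x₀ x₁ : S) (θ : ℝ) (hθ : θ ∈ Set.Icc (0 : ℝ) 1) : PMF S :=
  PMF.ofFintype (fun s => ENNReal.ofReal
      ((if s = x₀ then (1 + θ) / 2 else 0) + (if s = x₁ then (1 - θ) / 2 else 0))) <| by
    obtain ⟨h0, h1⟩ := hθ
    rw [← ENNReal.ofReal_sum_of_nonneg, Finset.sum_add_distrib]
    · simp only [Finset.sum_ite_eq', Finset.mem_univ, if_true]
      rw [show (1 + θ) / 2 + (1 - θ) / 2 = 1 by ring, ENNReal.ofReal_one]
    · intro s _
      split_ifs <;> linarith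

theorem coin_toReal (x₀ x₁ : S) (θ : ℝ) (hθ : θ ∈ Set.Icc (0 : ℝ) 1) (s : S) :
    (coin x₀ x₁ θ hθ s).toReal =
      (if s = x₀ then (1 + θ) / 2 else 0) + (if s = x₁ then (1 - θ) / 2 else 0) := by
  have h0 := hθ.1
  have h1 := hθ.2
  rw [coin, PMF.ofFintype_apply, ENNReal.toReal_ofReal]
  split_ifs <;> linarith

theorem sum_coin (x₀ x₁ : S) (θ : ℝ) (hθ : θ ∈ Set.Icc (0 : ℝ) 1) (f : S → ℝ) :
    ∑ s, (coin x₀ x₁ θ hθ s).toReal * f s = (1 + θ) / 2 * f x₀ + (1 - θ) / 2 * f x₁ := by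
  simp only [coin_toReal, add_mul, Finset.sum_add_distrib, ite_mul, zero_mul,
    Finset.sum_ite_eq', Finset.mem_univ, if_true]

end Coin

/-- Deterministic navigation `nav` together with `K` distinct state-action pairs, the arms, which
lead to one of the two states `x₀`, `x₁`. -/
structure ArmSystem (S A : Type) (K : ℕ) where
  nav : S → A → S
  arm : Fin K → S × A
  arm_injective : Function.Injective arm
  x₀ : S
  x₁ : S
  ne : x₁ ≠ x₀

namespace ArmSystem

variable {S A : Type} [Fintype S] [DecidableEq S] {K : ℕ} (E : ArmSystem S A K)

open Classical in
/-- The MDP in which arm `j` has bias `θ j`. -/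
def model (θ : Fin K → ℝ) (hθ : ∀ j, θ j ∈ Set.Icc (0 : ℝ) 1) : MDP S A where
  transition s a := if h : ∃ j, E.arm j = (s, a) then coin E.x₀ E.x₁ (θ h.choose) (hθ _)
    else PMF.pure (E.nav s a)
  reward _ _ := 0
  reward_mem _ _ := by simp

variable {θ : Fin K → ℝ} {hθ : ∀ j, θ j ∈ Set.Icc (0 : ℝ) 1}

theorem transition_arm (j : Fin K) :
    (E.model θ hθ).transition (E.arm j).1 (E.arm j).2 = coin E.x₀ E.x₁ (θ j) (hθ j) := by
  have h : ∃ i, E.arm i = ((E.arm j).1, (E.arm j).2) := ⟨j, rfl⟩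
  have h2 : h.choose = j := E.arm_injective h.choose_spec
  simp only [model, dif_pos h, h2]

theorem transition_nav {s : S} {a : A} (h : (s, a) ∉ Set.range E.arm) :
    (E.model θ hθ).transition s a = PMF.pure (E.nav s a) :=
  dif_neg h

/-- Bias `lam` at arm `i`, no bias at the other arms. -/
def bias (lam : ℝ) (i j : Fin K) : ℝ := if j = i then lam else 0

theorem bias_mem {lam : ℝ} (hlam : lam ∈ Set.Icc (0 : ℝ) 1) (i j : Fin K) :
    bias lam i j ∈ Set.Icc (0 : ℝ) 1 := by
  unfold bias
  split_ifs
  · exact hlam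
  · simp

/-- The base model, without bias. -/
def base : MDP S A := E.model (fun _ => 0) fun _ => by simp

/-- The model with bias `lam` at arm `i`. -/
def biased (lam : ℝ) (hlam : lam ∈ Set.Icc (0 : ℝ) 1) (i : Fin K) : MDP S A :=
  E.model (bias lam i) (bias_mem hlam i)

theorem isSeparable {lam : ℝ} (hlam : lam ∈ Set.Icc (0 : ℝ) 1) :
    IsSeparable lam (E.biased lam hlam) := by
  intro i j hij
  refine ⟨E.arm i, ?_⟩
  have hne := E.ne
  have h0 := hlam.1
  simp only [distinguishingSet, Set.mem_ofPred_eq, biased, transition_arm, l1Dist, coin_toReal]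
  have hb : bias lam i i = lam := by simp [bias]
  have hb' : bias lam j i = 0 := by simp [bias, hij]
  rw [hb, hb']
  calc lam = ∑ s, ((if s = E.x₀ then lam / 2 else 0) + (if s = E.x₁ then lam / 2 else 0)) := by
        simp [Finset.sum_add_distrib]
    _ ≤ _ := by
        refine Finset.sum_le_sum fun s _ => ?_
        by_cases h1 : s = E.x₀
        · subst h1
          simp only [if_true, if_neg hne.symm]
          refine le_trans (le_of_eq ?_) (le_abs_self _)
          ring
        · by_cases h2 : s = E.x₁
          · simp only [h2, if_true, if_neg hne]
            refine le_trans (le_of_eq ?_) (neg_le_abs _)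
            ring
          · simp [h1, h2]

/-! ### The lower bound -/

section LowerBound

variable [Fintype A] [DecidableEq A]

/-- `1` at `x₀`, `-1` at `x₁`, and `0` elsewhere. -/
def sgn (s : S) : ℝ := if s = E.x₀ then 1 else if s = E.x₁ then -1 else 0

@[simp] theorem sgn_x₀ : E.sgn E.x₀ = 1 := by simp [sgn]

@[simp] theorem sgn_x₁ : E.sgn E.x₁ = -1 := by simp [sgn, E.ne]

theorem coin_toReal_eq_mul (t : ℝ) (ht : t ∈ Set.Icc (0 : ℝ) 1) (s : S) :
    (coin E.x₀ E.x₁ t ht s).toReal =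
      (coin E.x₀ E.x₁ 0 (by simp) s).toReal * (1 + t * E.sgn s) := by
  have hne := E.ne
  simp only [coin_toReal, sgn]
  by_cases h1 : s = E.x₀
  · subst h1
    simp [hne.symm]
    ring
  · by_cases h2 : s = E.x₁
    · simp [h2, hne]
      ring
    · simp [h1, h2]

/-- The log-likelihood ratio of one sample, of bias `lam` at arm `i` against no bias. -/
def logRatio (lam : ℝ) (i : Fin K) (z : Sample S A) : ℝ :=
  if (z.1, z.2.1) = E.arm i then Real.log (1 + lam * E.sgn z.2.2) else 0

/-- The log-likelihood ratio of a history. -/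
def logLikelihood (lam : ℝ) (i : Fin K) (h : List (Sample S A)) : ℝ :=
  (h.map (E.logRatio lam i)).sum

theorem one_add_mul_sgn_pos {lam : ℝ} (hlam : lam ∈ Set.Ico (0 : ℝ) 1) (s : S) :
    0 < 1 + lam * E.sgn s := by
  have h0 := hlam.1
  have h1 := hlam.2
  unfold sgn
  split_ifs <;> linarith

/-- The sampling rule is the same under both models, so its probabilities cancel and only the
factors `1 ± lam` at arm `i` remain. -/
theorem expect_biased_eq {lam : ℝ} (hlam : lam ∈ Set.Ico (0 : ℝ) 1) (i : Fin K)
    (q : Sampler S A) (n : ℕ) (F : List (Sample S A) → ℝ) :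
    (E.biased lam ⟨hlam.1, hlam.2.le⟩ i).expect q n F =
      E.base.expect q n fun h => Real.exp (E.logLikelihood lam i h) * F h := by
  refine MDP.expect_change _ q _ (by simp [logLikelihood]) ?_ n F
  rintro h ⟨s, a⟩ s'
  rw [logLikelihood, List.map_append, List.sum_append, Real.exp_add, ← logLikelihood, mul_left_comm]
  congr 1
  simp only [List.map_cons, List.map_nil, List.sum_cons, List.sum_nil, add_zero, logRatio]
  by_cases hr : (s, a) ∈ Set.range E.arm
  · obtain ⟨j, hj⟩ := hr
    obtain ⟨rfl, rfl⟩ : (E.arm j).1 = s ∧ (E.arm j).2 = a := by simp [hj]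
    simp only [base, biased, transition_arm]
    rw [E.coin_toReal_eq_mul (bias lam i j)]
    congr 1
    by_cases hij : j = i
    · subst hij
      simp [bias, Real.exp_log (E.one_add_mul_sgn_pos hlam s')]
    · simp [bias, hij, E.arm_injective.eq_iff]
  · have hi : (s, a) ≠ E.arm i := fun h => hr ⟨i, h.symm⟩
    simp [base, biased, E.transition_nav hr, hi]

/-- At an arm only one summand is nonzero, and its mean under a fair coin is `log (1 - lam ^ 2) /
2`. Off the arms all summands vanish. -/
theorem sum_logRatio_base {lam : ℝ} (hlam : lam ∈ Set.Ioc (0 : ℝ) (1 / 2)) (x : S × A) :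
    -(2 / 3 * lam ^ 2) ≤ ∑ s, (E.base.transition x.1 x.2 s).toReal *
      ∑ i, E.logRatio lam i (x.1, x.2, s) := by
  obtain ⟨h0, h1⟩ := hlam
  by_cases hr : x ∈ Set.range E.arm
  · obtain ⟨j, rfl⟩ := hr
    have hs : ∀ s, ∑ i, E.logRatio lam i ((E.arm j).1, (E.arm j).2, s) =
        Real.log (1 + lam * E.sgn s) := by
      intro s
      rw [Finset.sum_eq_single j]
      · simp [logRatio]
      · intro i _ hij
        simp [logRatio, E.arm_injective.eq_iff, hij.symm]
      · simp
    simp only [hs, base, transition_arm, sum_coin, sgn_x₀, sgn_x₁]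
    have hpos : 0 < 1 - lam ^ 2 := by nlinarith
    have hlog : Real.log (1 + lam * 1) + Real.log (1 + lam * -1) = Real.log (1 - lam ^ 2) := by
      rw [← Real.log_mul (by linarith) (by linarith)]
      congr 1
      ring
    have hb := Real.one_sub_inv_le_log_of_pos hpos
    -- With `y = lam ^ 2 ≤ 1 / 4`, `(1 - y) * (1 + 4 / 3 * y) - 1 = 4 / 3 * y * (1 / 4 - y)`.
    have hinv : (1 - lam ^ 2)⁻¹ ≤ 1 + 4 / 3 * lam ^ 2 := by
      rw [inv_le_iff_one_le_mul₀ hpos]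
      nlinarith [sq_nonneg lam, mul_nonneg (sq_nonneg lam) (show 0 ≤ 1 / 4 - lam ^ 2 by nlinarith)]
    linarith
  · have hi : ∀ i, x ≠ E.arm i := fun i h => hr ⟨i, h.symm⟩
    simp only [logRatio, Prod.mk.eta, hi, if_false, Finset.sum_const_zero, mul_zero]
    nlinarith

/-- Truncation of the likelihood ratio at 2: below 2 the term `2 * g` suffices; above 2 the excess
is at most `exp t - 2`, and `2 * t ≤ exp t`. -/
theorem exp_mul_le (t g : ℝ) (h0 : 0 ≤ g) (h1 : g ≤ 1) :
    Real.exp t * g ≤ 2 * g + 2 * (Real.exp t - 1 - t) := by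
  have ht := Real.add_one_le_exp t
  rcases le_total (Real.exp t) 2 with h | h
  · nlinarith
  · have h2 : 2 * t ≤ Real.exp t := by
      have h3 := Real.add_one_le_exp (t - 1)
      have h4 : Real.exp t = Real.exp (t - 1) * Real.exp 1 := by rw [← Real.exp_add]; simp
      have h5 := Real.add_one_le_exp (1 : ℝ)
      nlinarith [Real.exp_pos (t - 1)]
    nlinarith

theorem sum_outputLaw_le {lam : ℝ} (hlam : lam ∈ Set.Ioc (0 : ℝ) (1 / 2))
    (hlam' : lam ∈ Set.Icc (0 : ℝ) 1) (q : Sampler S A)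
    (n : ℕ) (C : Classifier S A K) :
    ∑ i, ((E.biased lam hlam' i).outputLaw q n C i).toReal ≤ 2 + 4 / 3 * lam ^ 2 * n := by
  have hI : lam ∈ Set.Ico (0 : ℝ) 1 := ⟨hlam.1.le, by linarith [hlam.2]⟩
  have hone : ∀ i, E.base.expect q n (fun h => Real.exp (E.logLikelihood lam i h)) = 1 := by
    intro i
    have := E.expect_biased_eq hI i q n (fun _ => 1)
    simpa [MDP.expect_const] using this.symm
  have hlog : -(2 / 3 * lam ^ 2 * n) ≤
      E.base.expect q n fun h => ∑ i, E.logLikelihood lam i h := by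
    have := E.base.le_expect_of_step q (F := fun h => ∑ i, E.logLikelihood lam i h)
      (c := -(2 / 3 * lam ^ 2)) ?_ n
    · simp only [logLikelihood, List.map_nil, List.sum_nil, Finset.sum_const_zero] at this ⊢
      linarith
    · intro h x
      have hx := E.sum_logRatio_base hlam x
      simp only [logLikelihood, List.map_append, List.sum_append, List.map_cons, List.map_nil,
        List.sum_cons, List.sum_nil, add_zero, Finset.sum_add_distrib, mul_add, ← Finset.sum_mul,
        pmf_sum_toReal, one_mul] at hx ⊢
      linarith
  calc ∑ i, ((E.biased lam hlam' i).outputLaw q n C i).toReal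
      = E.base.expect q n fun h =>
          ∑ i, Real.exp (E.logLikelihood lam i h) * (C h i).toReal := by
        rw [MDP.expect_sum]
        exact Finset.sum_congr rfl fun i _ => by
          rw [MDP.outputLaw_toReal, E.expect_biased_eq hI]
    -- The output probabilities sum to 1, which gives the 2. The `-2 * K` cancels later because each
    -- likelihood ratio has base mean 1.
    _ ≤ E.base.expect q n fun h => (2 - 2 * K) + (2 * ∑ i, Real.exp (E.logLikelihood lam i h) +
          (-2) * ∑ i, E.logLikelihood lam i h) := by
        refine MDP.expect_mono _ _ _ fun h => ?_
        calc _ ≤ ∑ i, (2 * (C h i).toReal + 2 * (Real.exp (E.logLikelihood lam i h) - 1 -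
                E.logLikelihood lam i h)) := Finset.sum_le_sum fun i _ =>
              exp_mul_le _ _ ENNReal.toReal_nonneg
                (ENNReal.toReal_le_of_le_ofReal zero_le_one (by simpa using (C h).coe_le_one i))
          _ = _ := by
              simp only [Finset.sum_add_distrib, ← Finset.mul_sum, Finset.sum_sub_distrib,
                pmf_sum_toReal, Finset.sum_const, Finset.card_univ, Fintype.card_fin,
                nsmul_eq_mul]
              ring
    _ = 2 + -2 * E.base.expect q n fun h => ∑ i, E.logLikelihood lam i h := by
        rw [MDP.expect_add, MDP.expect_add, MDP.expect_const_mul, MDP.expect_const_mul,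
          MDP.expect_const, MDP.expect_sum _ _ _ _ (fun i h => Real.exp (E.logLikelihood lam i h))]
        simp only [hone, Finset.sum_const, Finset.card_univ, Fintype.card_fin, nsmul_eq_mul]
        ring
    _ ≤ _ := by linarith

theorem exists_half_le_failure {lam : ℝ} (hlam : lam ∈ Set.Ioc (0 : ℝ) (1 / 2))
    (hlam' : lam ∈ Set.Icc (0 : ℝ) 1) (q : Sampler S A) (n : ℕ) (C : Classifier S A K)
    (hn : 2 + 4 / 3 * lam ^ 2 * n < K / 2) :
    ∃ i, 1 / 2 ≤ ((E.biased lam hlam' i).outputLaw q n C).toOuterMeasure {j | j ≠ i} := by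
  obtain ⟨i, hi⟩ : ∃ i, ((E.biased lam hlam' i).outputLaw q n C i).toReal ≤ 1 / 2 := by
    by_contra! hcon
    have h1 : ∑ _i : Fin K, (1 / 2 : ℝ) ≤
        ∑ i, ((E.biased lam hlam' i).outputLaw q n C i).toReal :=
      Finset.sum_le_sum fun i _ => (hcon i).le
    have h2 := E.sum_outputLaw_le hlam hlam' q n C
    simp only [Finset.sum_const, Finset.card_univ, Fintype.card_fin, nsmul_eq_mul] at h1
    linarith
  refine ⟨i, ?_⟩
  set p := (E.biased lam hlam' i).outputLaw q n C
  have hsum : p.toOuterMeasure {j | j ≠ i} + p i = 1 := by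
    rw [PMF.toOuterMeasure_apply_fintype, ← p.tsum_coe, tsum_fintype (L := .unconditional _),
      ← Finset.sum_erase_add _ _ (Finset.mem_univ i),
      ← Finset.sum_erase_add (a := i) (f := fun j => p j) _ (Finset.mem_univ i)]
    simp only [Set.indicator, Set.mem_ofPred_eq, ne_eq, not_true, if_false, add_zero]
    congr 1
    exact Finset.sum_congr rfl fun j hj => if_pos (Finset.ne_of_mem_erase hj)
  have hle : p i ≤ 1 / 2 := by
    rw [← ENNReal.ofReal_toReal (p.apply_ne_top i)]
    refine (ENNReal.ofReal_le_ofReal hi).trans (le_of_eq ?_)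
    rw [ENNReal.ofReal_div_of_pos two_pos]
    simp
  have h1 : (1 : ℝ≥0∞) = 1 / 2 + 1 / 2 := (ENNReal.add_halves 1).symm
  rw [h1] at hsum
  by_contra! hlt
  exact absurd hsum (ENNReal.add_lt_add_of_lt_of_le (p.apply_ne_top i) hlt hle).ne

end LowerBound

end ArmSystem

namespace ArmSystem

variable {S A : Type} {K : ℕ} (E : ArmSystem S A K)

/-- There is a walk of exactly `k` deterministic steps, away from the arms. -/
def Walk : ℕ → S → S → Prop
  | 0, v, w => v = w
  | k + 1, v, w => ∃ a, (v, a) ∉ Set.range E.arm ∧ Walk k (E.nav v a) w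

/-! ### The diameter -/

section Diameter

/-- Until `w` is hit, time plus potential never exceeds `d s`. Since `d` is positive, `w` is hit
within `d s` steps, so at most `d s` tail probabilities are nonzero. -/
theorem expectedPassageTime_le_of_potential (m : MDP S A) (μ : S → A) (w : S) (d : S → ℕ)
    (hpos : ∀ v, 0 < d v)
    (hd : ∀ v, ∀ s ∈ (m.transition v (μ v)).support, s = w ∨ d s + 1 ≤ d v) (s : S) :
    m.expectedPassageTime μ s w ≤ d s := by
  have hI : ∀ n, ∀ h ∈ (m.sampleLaw ((stationary μ).run s) n).support,
      (∃ x ∈ h, x.2.2 = w) ∨ n + d (currentState s h) ≤ d s := by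
    refine m.support_invariant _ _ (by simp [currentState]) ?_
    rintro n h hI ⟨v, a⟩ s' hx hs'
    simp only [Policy.run, stationary, PMF.pure_map, PMF.support_pure, Set.mem_singleton_iff,
      Prod.mk.injEq] at hx
    obtain ⟨rfl, rfl⟩ := hx
    rcases hI with ⟨x, hx, hxw⟩ | hI
    · exact .inl ⟨x, by simp [hx], hxw⟩
    · rcases hd _ s' hs' with rfl | hlt
      · exact .inl ⟨_, List.mem_append_right _ (List.mem_singleton_self _), rfl⟩
      · right
        rw [currentState_append]
        dsimp only at hlt ⊢
        omega
  have hzero : ∀ n ∉ Finset.range (d s), (m.sampleLaw ((stationary μ).run s) n).toOuterMeasure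
      {h | ∀ x ∈ h, x.2.2 ≠ w} = 0 := by
    intro n hn
    rw [PMF.toOuterMeasure_apply_eq_zero_iff, Set.disjoint_left]
    intro h hh hw
    rcases hI n h hh with ⟨x, hx, hxw⟩ | hle
    · exact hw x hx hxw
    · have := hpos (currentState s h)
      simp only [Finset.mem_range] at hn
      omega
  rw [MDP.expectedPassageTime, tsum_eq_sum hzero]
  calc _ ≤ ∑ _n ∈ Finset.range (d s), (1 : ℝ≥0∞) := Finset.sum_le_sum fun n _ => by
        rw [PMF.toOuterMeasure_apply]
        exact (ENNReal.tsum_le_tsum fun h => Set.indicator_le_self _ _ h).trans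
          (PMF.tsum_coe _).le
    _ = d s := by simp

variable [Fintype S] [DecidableEq S]

theorem diameter_le {T : ℕ} (hT0 : 0 < T) (hT : ∀ v w, E.Walk T v w) (θ : Fin K → ℝ)
    (hθ : ∀ j, θ j ∈ Set.Icc (0 : ℝ) 1) : (E.model θ hθ).diameter ≤ T := by
  classical
  refine iSup_le fun s => iSup_le fun w => ?_
  -- The potential is the least positive walk length. Positivity matters at `w` itself, where the
  -- passage time is a return time.
  have hex : ∀ v, ∃ k, 0 < k ∧ E.Walk k v w := fun v => ⟨T, hT0, hT v w⟩
  have hact : ∀ v, ∃ a, (v, a) ∉ Set.range E.arm ∧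
      (E.nav v a = w ∨ Nat.find (hex (E.nav v a)) + 1 ≤ Nat.find (hex v)) := by
    intro v
    obtain ⟨hpos, hw⟩ := Nat.find_spec (hex v)
    obtain ⟨k, hk⟩ : ∃ k, Nat.find (hex v) = k + 1 := ⟨_, (Nat.succ_pred_eq_of_pos hpos).symm⟩
    rw [hk] at hw ⊢
    obtain ⟨a, ha, hw⟩ := hw
    refine ⟨a, ha, ?_⟩
    rcases Nat.eq_zero_or_pos k with rfl | hk0
    · exact .inl hw
    · exact .inr (Nat.succ_le_succ (Nat.find_le ⟨hk0, hw⟩))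
  choose μ hμ hμ' using hact
  refine (iInf_le _ μ).trans ?_
  refine (expectedPassageTime_le_of_potential _ μ w (fun v => Nat.find (hex v))
    (fun v => (Nat.find_spec (hex v)).1) ?_ s).trans ?_
  · intro v s' hs'
    rw [E.transition_nav (hμ v), PMF.support_pure, Set.mem_singleton_iff] at hs'
    rw [hs']
    exact hμ' v
  · exact_mod_cast Nat.find_le (h := hex s) ⟨hT0, hT s w⟩

end Diameter

/-! ### Identification -/

section Identification

variable [NeZero K]

/-- The arm that is pulled in the block of `T + 1` steps that contains step `t`. -/
def target (T t : ℕ) : Fin K := Fin.ofNat K (t / (T + 1))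

theorem exists_scheduled_action (T t : ℕ) (v : S) :
    ∃ a, (t % (T + 1) = T → a = (E.arm (target T t)).2) ∧
      ∀ k, t % (T + 1) + (k + 1) = T → E.Walk (k + 1) v (E.arm (target T t)).1 →
        (v, a) ∉ Set.range E.arm ∧ E.Walk k (E.nav v a) (E.arm (target T t)).1 := by
  by_cases ht : t % (T + 1) = T
  · exact ⟨_, fun _ => rfl, fun k hk => by omega⟩
  by_cases hw : ∃ k, t % (T + 1) + (k + 1) = T ∧ E.Walk (k + 1) v (E.arm (target T t)).1
  · obtain ⟨k, hk, a, ha⟩ := hw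
    refine ⟨a, fun h => absurd h ht, fun k' hk' _ => ?_⟩
    obtain rfl : k = k' := by omega
    exact ha
  -- An arbitrary action: no walk of the required length exists, so nothing is demanded.
  · exact ⟨(E.arm (target T t)).2, fun h => absurd h ht, fun k hk hk' => absurd ⟨k, hk, hk'⟩ hw⟩

/-- In each block of `T + 1` steps, walk to the state of the target arm and pull that arm. -/
def blockPolicy (T : ℕ) : Policy S A := fun h v =>
  PMF.pure (E.exists_scheduled_action T h.length v).choose

variable [DecidableEq S] [DecidableEq A]

/-- The number of samples from arm `j`. -/
def pulls (j : Fin K) (h : List (Sample S A)) : ℝ :=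
  (h.map fun z => if (z.1, z.2.1) = E.arm j then (1 : ℝ) else 0).sum

theorem pulls_append (j : Fin K) (h : List (Sample S A)) (z : Sample S A) :
    E.pulls j (h ++ [z]) = E.pulls j h + if (z.1, z.2.1) = E.arm j then (1 : ℝ) else 0 := by
  simp [pulls]

/-- The number of times before `t` at which the block policy pulls arm `j`. -/
def scheduledPulls (T t : ℕ) (j : Fin K) : ℝ :=
  ∑ u ∈ Finset.range t, if u % (T + 1) = T ∧ target T u = j then (1 : ℝ) else 0

theorem le_scheduledPulls (T k : ℕ) (j : Fin K) :
    (k : ℝ) ≤ scheduledPulls T (k * (K * (T + 1))) j := by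
  induction k with
  | zero => simp [scheduledPulls]
  | succ k ih =>
    have hj := j.isLt
    have h1 : (j : ℕ) * (T + 1) + T < K * (T + 1) := by nlinarith
    -- The last step of block `j` in the next round of `K` blocks, where arm `j` is pulled once
    -- more.
    have hu : k * (K * (T + 1)) + (j * (T + 1) + T) = (T + 1) * (K * k + j) + T := by ring
    have hge := Finset.single_le_sum
      (f := fun u => if (k * (K * (T + 1)) + u) % (T + 1) = T ∧
        target T (k * (K * (T + 1)) + u) = j then (1 : ℝ) else 0)
      (fun u _ => by split_ifs <;> norm_num) (Finset.mem_range.2 h1)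
    have hc : (k * (K * (T + 1)) + (j * (T + 1) + T)) % (T + 1) = T ∧
        target T (k * (K * (T + 1)) + (j * (T + 1) + T)) = j := by
      rw [hu]
      refine ⟨by rw [Nat.mul_add_mod, Nat.mod_eq_of_lt (Nat.lt_succ_self T)], Fin.ext ?_⟩
      rw [target, Fin.val_ofNat, Nat.mul_add_div (Nat.succ_pos T),
        Nat.div_eq_of_lt (Nat.lt_succ_self T), add_zero, Nat.mul_add_mod, Nat.mod_eq_of_lt hj]
    rw [if_pos hc] at hge
    rw [scheduledPulls, Nat.succ_mul, Finset.sum_range_add, ← scheduledPulls]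
    push_cast
    linarith

variable [Fintype S]

/-- Navigation shortens the remaining walk by one. After a pull the position is random, but `hT`
supplies a fresh walk of length `T` from any state. -/
theorem blockPolicy_invariant {T : ℕ} (hT : ∀ v w, E.Walk T v w) (θ : Fin K → ℝ)
    (hθ : ∀ j, θ j ∈ Set.Icc (0 : ℝ) 1) (s₁ : S) (t : ℕ) (h : List (Sample S A))
    (hI : h.length = t ∧ E.Walk (T - t % (T + 1)) (currentState s₁ h) (E.arm (target T t)).1 ∧
      ∀ j, scheduledPulls T t j ≤ E.pulls j h)
    (x : S × A) (s : S) (hx : (E.blockPolicy T).run s₁ h x ≠ 0)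
    (hs : (E.model θ hθ).transition x.1 x.2 s ≠ 0) :
    (h ++ [(x.1, x.2, s)]).length = t + 1 ∧
      E.Walk (T - (t + 1) % (T + 1)) (currentState s₁ (h ++ [(x.1, x.2, s)]))
        (E.arm (target T (t + 1))).1 ∧
      ∀ j, scheduledPulls T (t + 1) j ≤ E.pulls j (h ++ [(x.1, x.2, s)]) := by
  obtain ⟨rfl, hw, hN⟩ := hI
  have hx' : x ∈ ((E.blockPolicy T).run s₁ h).support := hx
  simp only [Policy.run, blockPolicy, PMF.pure_map, PMF.support_pure,
    Set.mem_singleton_iff] at hx'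
  obtain ⟨ha1, ha2⟩ := (E.exists_scheduled_action T h.length (currentState s₁ h)).choose_spec
  set a := (E.exists_scheduled_action T h.length (currentState s₁ h)).choose
  subst hx'
  set t := h.length
  have hdm := Nat.div_add_mod t (T + 1)
  have hlt : t % (T + 1) < T + 1 := Nat.mod_lt t (Nat.succ_pos T)
  refine ⟨by simp [t], ?_, ?_⟩
  · rw [currentState_append]
    dsimp only
    by_cases hr : t % (T + 1) = T
    · have h1 : (t + 1) % (T + 1) = 0 := by
        rw [← hdm, hr, add_assoc, Nat.mul_add_mod, Nat.mod_self]
      rw [h1]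
      exact hT _ _
    · have hr' : t % (T + 1) + 1 < T + 1 := by omega
      have h1 : (t + 1) % (T + 1) = t % (T + 1) + 1 := by
        conv_lhs => rw [← hdm, add_assoc, Nat.mul_add_mod, Nat.mod_eq_of_lt hr']
      have h2 : target (K := K) T (t + 1) = target T t := by
        unfold target
        congr 1
        conv_lhs => rw [← hdm, add_assoc, Nat.mul_add_div (Nat.succ_pos T),
          Nat.div_eq_of_lt hr', add_zero]
      obtain ⟨k, hk⟩ : ∃ k, T - t % (T + 1) = k + 1 := ⟨T - t % (T + 1) - 1, by omega⟩
      rw [hk] at hw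
      obtain ⟨hna, hw'⟩ := ha2 k (by omega) hw
      have hs' : s ∈ ((E.model θ hθ).transition (currentState s₁ h) a).support := hs
      rw [E.transition_nav hna, PMF.support_pure, Set.mem_singleton_iff] at hs'
      rw [h1, h2, hs', show T - (t % (T + 1) + 1) = k by omega]
      exact hw'
  · intro j
    have hj := hN j
    rw [scheduledPulls, Finset.sum_range_succ, ← scheduledPulls, pulls_append]
    refine add_le_add hj ?_
    by_cases hr : t % (T + 1) = T ∧ target T t = j
    · obtain ⟨hr, rfl⟩ := hr
      rw [hr, Nat.sub_self] at hw
      have hw : currentState s₁ h = (E.arm (target T t)).1 := hw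
      rw [hw, ha1 hr]
      simp [hr]
    · rw [if_neg hr]
      split_ifs <;> norm_num

/-- The sum of the signs of the samples from arm `j`. -/
def signSum (j : Fin K) (h : List (Sample S A)) : ℝ :=
  (h.map fun z => if (z.1, z.2.1) = E.arm j then E.sgn z.2.2 else 0).sum

theorem signSum_append (j : Fin K) (h : List (Sample S A)) (z : Sample S A) :
    E.signSum j (h ++ [z]) = E.signSum j h + if (z.1, z.2.1) = E.arm j then E.sgn z.2.2 else 0 := by
  simp [signSum]

open Classical in
/-- Output an arm whose mean sign exceeds half the bias. -/
def threshold (lam : ℝ) : Classifier S A K := fun h =>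
  PMF.pure (if hj : ∃ j, lam / 2 * E.pulls j h < E.signSum j h then hj.choose else 0)

theorem threshold_apply {lam k : ℝ} (hlam : 0 < lam) (i : Fin K) (h : List (Sample S A))
    (hN : ∀ j, k ≤ E.pulls j h)
    (hY : ∀ j, |E.signSum j h - bias lam i j * E.pulls j h| < lam * k / 2) :
    E.threshold lam h i = 1 := by
  have hi : lam / 2 * E.pulls i h < E.signSum i h := by
    have h1 := (abs_lt.1 (hY i)).1
    have h2 := hN i
    simp only [bias, if_true] at h1
    nlinarith
  have hex : ∃ j, lam / 2 * E.pulls j h < E.signSum j h := ⟨i, hi⟩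
  have hch : hex.choose = i := by
    by_contra hne
    have h0 := hex.choose_spec
    have h1 := (abs_lt.1 (hY hex.choose)).2
    have h2 := hN hex.choose
    simp only [bias, hne, if_false, zero_mul, sub_zero] at h1
    nlinarith
  simp [threshold, hex, hch]

variable [Fintype A]

/-- The deviation is a martingale whose increments have conditional variance `1 - θ j ^ 2` at arm
`j` and 0 elsewhere. -/
theorem expect_sq_deviation_le (θ : Fin K → ℝ) (hθ : ∀ j, θ j ∈ Set.Icc (0 : ℝ) 1)
    (q : Sampler S A) (n : ℕ) (j : Fin K) :
    (E.model θ hθ).expect q n (fun h => (E.signSum j h - θ j * E.pulls j h) ^ 2) ≤ n := by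
  have := (E.model θ hθ).le_expect_of_step q (c := -1)
    (F := fun h => -1 * (E.signSum j h - θ j * E.pulls j h) ^ 2) ?_ n
  · rw [MDP.expect_const_mul] at this
    simp only [signSum, pulls, List.map_nil, List.sum_nil] at this ⊢
    linarith
  · intro h x
    simp only [signSum_append, pulls_append, Prod.mk.eta]
    by_cases hx : x = E.arm j
    · subst hx
      simp only [transition_arm, if_true, sum_coin, sgn_x₀, sgn_x₁]
      nlinarith [sq_nonneg (θ j)]
    · simp only [hx, if_false, add_zero, ← Finset.sum_mul, pmf_sum_toReal]
      linarith

/-- Chebyshev's inequality with a union over the arms: failure needs some deviation of at least `c =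
lam * k / 2`, so its probability is at most `K * n / c ^ 2`. -/
theorem outputLaw_threshold_ge {T : ℕ} (hT : ∀ v w, E.Walk T v w) {lam : ℝ} (hlam0 : 0 < lam)
    (hlam : lam ∈ Set.Icc (0 : ℝ) 1) (i : Fin K) (s₁ : S) {k : ℕ} (hk : 0 < k) :
    1 - 4 * K ^ 2 * (T + 1) / (lam ^ 2 * k) ≤
      ((E.biased lam hlam i).outputLaw ((E.blockPolicy T).run s₁) (k * (K * (T + 1)))
        (E.threshold lam) i).toReal := by
  have hk' : (0 : ℝ) < k := by exact_mod_cast hk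
  set n := k * (K * (T + 1)) with hn
  set c := lam * k / 2 with hc
  have hc0 : 0 < c := by positivity
  set m := E.biased lam hlam i
  set q := (E.blockPolicy T).run s₁
  let Y : Fin K → List (Sample S A) → ℝ := fun j h =>
    E.signSum j h - bias lam i j * E.pulls j h
  have hY : ∀ j, m.expect q n (fun h => Y j h ^ 2) ≤ n := fun j =>
    E.expect_sq_deviation_le _ _ _ _ j
  rw [MDP.outputLaw_toReal]
  calc 1 - 4 * K ^ 2 * (T + 1) / (lam ^ 2 * k) = 1 + (-(1 / c ^ 2)) * ∑ _j : Fin K, (n : ℝ) := by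
        simp only [Finset.sum_const, Finset.card_univ, Fintype.card_fin, nsmul_eq_mul]
        rw [hc, hn]
        push_cast
        field_simp
        ring
    _ ≤ 1 + (-(1 / c ^ 2)) * ∑ j, m.expect q n (fun h => Y j h ^ 2) := by
        have h1 := Finset.sum_le_sum fun j (_ : j ∈ Finset.univ) => hY j
        have h2 : 0 ≤ 1 / c ^ 2 := by positivity
        nlinarith
    _ = m.expect q n fun h => 1 + (-(1 / c ^ 2)) * ∑ j, Y j h ^ 2 := by
        rw [MDP.expect_add, MDP.expect_const_mul, MDP.expect_sum, MDP.expect_const]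
    _ ≤ _ := by
        refine MDP.expect_mono_of_invariant m q _
          ⟨rfl, by simpa using hT _ _, fun j => by simp [scheduledPulls, pulls]⟩
          (fun t h hI x s => E.blockPolicy_invariant hT _ _ s₁ t h hI x s) n ?_
        rintro h ⟨-, -, hN⟩
        have hs : 0 ≤ ∑ j, Y j h ^ 2 := Finset.sum_nonneg fun j _ => sq_nonneg _
        by_cases hall : ∀ j, |Y j h| < c
        · rw [E.threshold_apply hlam0 i h (fun j => (le_scheduledPulls T k j).trans (hN j)) hall]
          have h2 : 0 ≤ 1 / c ^ 2 := by positivity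
          rw [ENNReal.toReal_one]
          nlinarith
        · push Not at hall
          obtain ⟨j, hj⟩ := hall
          refine le_trans ?_ ENNReal.toReal_nonneg
          have h1 : c ^ 2 ≤ ∑ j, Y j h ^ 2 := by
            refine le_trans ?_ (Finset.single_le_sum (f := fun j => Y j h ^ 2)
              (fun j _ => sq_nonneg _) (Finset.mem_univ j))
            rw [← sq_abs (Y j h)]
            exact pow_le_pow_left₀ hc0.le hj 2
          have h2 : 1 ≤ 1 / c ^ 2 * ∑ j, Y j h ^ 2 := by
            rw [div_mul_eq_mul_div, one_mul]
            exact (one_le_div (by positivity)).2 h1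
          linarith

theorem isPACIdentifiable {T : ℕ} (hT : ∀ v w, E.Walk T v w) {lam : ℝ} (hlam0 : 0 < lam)
    (hlam : lam ∈ Set.Icc (0 : ℝ) 1) : IsPACIdentifiable (E.biased lam hlam) := by
  refine ⟨fun p => (⌈4 * K ^ 2 * (T + 1) / (lam ^ 2 * (p : ℝ))⌉₊ + 1) * (K * (T + 1)),
    E.blockPolicy T, E.threshold lam, fun p i s₁ => ?_⟩
  have hp := p.2.1
  refine le_trans ?_ (E.outputLaw_threshold_ge hT hlam0 hlam i s₁ (Nat.succ_pos _))
  set B : ℝ := 4 * K ^ 2 * (T + 1) with hB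
  have hceil := Nat.le_ceil (B / (lam ^ 2 * (p : ℝ)))
  rw [div_le_iff₀ (by positivity)] at hceil
  gcongr
  rw [div_le_iff₀ (by positivity)]
  push_cast
  nlinarith [show 0 < lam ^ 2 * (p : ℝ) by positivity]

end Identification

end ArmSystem

/-! ### The de Bruijn graph and its walks -/

section DeBruijn

/-- A de Bruijn graph on `S` states, with `A - A / 2` navigating actions, and with `A / 2` actions
left for the arms in each state. -/
def deBruijn (S A K : ℕ) (hS : 2 ≤ S) (hA : 2 ≤ A) (hK : K ≤ S * (A / 2)) :
    ArmSystem (Fin S) (Fin A) K where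
  nav v a := ⟨((A - A / 2) * v + a) % S, Nat.mod_lt _ (by omega)⟩
  arm i := (⟨i / (A / 2), Nat.div_lt_of_lt_mul (by rw [mul_comm]; exact i.isLt.trans_le hK)⟩,
    ⟨A - A / 2 + i % (A / 2), by have := Nat.mod_lt i (show 0 < A / 2 by omega); omega⟩)
  arm_injective i j hij := by
    simp only [Prod.mk.injEq, Fin.mk.injEq] at hij
    have h1 := Nat.div_add_mod i (A / 2)
    have h2 := Nat.div_add_mod j (A / 2)
    rw [hij.1, show (i : ℕ) % (A / 2) = j % (A / 2) by omega] at h1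
    exact Fin.ext (h1.symm.trans h2)
  x₀ := ⟨0, by omega⟩
  x₁ := ⟨1, by omega⟩
  ne := by simp

variable {S A K : ℕ} (hS : 2 ≤ S) (hA : 2 ≤ A) (hK : K ≤ S * (A / 2))

/-- The actions are the base-`(A - A / 2)` digits of `c`, most significant first; each step shifts
in one digit. -/
theorem deBruijn_walk_aux (t : ℕ) : ∀ (v w : Fin S) (c : ℕ), c < (A - A / 2) ^ t →
    (w : ℕ) ≡ (A - A / 2) ^ t * v + c [MOD S] → (deBruijn S A K hS hA hK).Walk t v w := by
  induction t with
  | zero =>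
    intro v w c hc hw
    obtain rfl : c = 0 := by simpa using hc
    simp only [pow_zero, one_mul, add_zero] at hw
    exact Fin.ext (hw.eq_of_lt_of_lt w.isLt v.isLt).symm
  | succ t ih =>
    intro v w c hc hw
    set b := A - A / 2 with hb
    have ha : c / b ^ t < b := Nat.div_lt_of_lt_mul (by rwa [← pow_succ])
    refine ⟨⟨c / b ^ t, by omega⟩, ?_, ?_⟩
    · rintro ⟨i, hi⟩
      simp only [deBruijn, Prod.mk.injEq, Fin.mk.injEq] at hi
      omega
    · refine ih _ w (c % b ^ t) (Nat.mod_lt _ (pow_pos (by omega) t)) ?_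
      refine hw.trans ?_
      have h1 := Nat.div_add_mod c (b ^ t)
      have h2 : b ^ (t + 1) * v + c = b ^ t * (b * v + c / b ^ t) + c % b ^ t := by
        conv_lhs => rw [← h1]
        ring
      rw [h2]
      exact Nat.ModEq.add_right _ (Nat.ModEq.mul_left _ (Nat.mod_modEq _ _).symm)

theorem deBruijn_walk {T : ℕ} (hT : S ≤ (A - A / 2) ^ T) (v w : Fin S) :
    (deBruijn S A K hS hA hK).Walk T v w := by
  set b := A - A / 2
  have hv := Nat.mod_lt (b ^ T * v) (show 0 < S by omega)
  -- The residue of `w - b ^ T * v` modulo `S`, which has at most `T` digits because `S ≤ b ^ T`.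
  refine deBruijn_walk_aux hS hA hK T v w ((w + (S - b ^ T * v % S)) % S)
    ((Nat.mod_lt _ (by omega)).trans_le hT) ?_
  have h1 : b ^ T * v + (w + (S - b ^ T * v % S)) % S ≡
      b ^ T * v % S + (w + (S - b ^ T * v % S)) [MOD S] :=
    (Nat.mod_modEq _ _).symm.add (Nat.mod_modEq _ _)
  refine Nat.ModEq.trans ?_ h1.symm
  rw [show b ^ T * v % S + (w + (S - b ^ T * v % S)) = w + S by omega]
  exact (Nat.add_modEq_right).symm

end DeBruijn

/-- The slack in `D / 2` absorbs both the factor 3, by `3 ≤ (A / 2) ^ (D / 2 - 1)`, and the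
rounding, by `D - 1 < ⌊D⌋₊`. -/
theorem le_half_pow_floor {S A : ℕ} (hS : 20 ≤ S) (hA : 20 ≤ A) {D : ℝ} (hD : 16 ≤ D)
    (hDlog : Real.logb ((A : ℝ) / 2) ((S : ℝ) / 3) ≤ D / 2) : S ≤ (A - A / 2) ^ ⌊D⌋₊ := by
  have hA' : (20 : ℝ) ≤ A := by exact_mod_cast hA
  have hS' : (20 : ℝ) ≤ S := by exact_mod_cast hS
  have h1 : (S : ℝ) / 3 ≤ ((A : ℝ) / 2) ^ (D / 2) :=
    (Real.logb_le_iff_le_rpow (by linarith) (by linarith)).1 hDlog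
  have h2 : (3 : ℝ) ≤ ((A : ℝ) / 2) ^ (D / 2 - 1) :=
    calc (3 : ℝ) ≤ (A : ℝ) / 2 := by linarith
      _ = ((A : ℝ) / 2) ^ (1 : ℝ) := (Real.rpow_one _).symm
      _ ≤ _ := Real.rpow_le_rpow_of_exponent_le (by linarith) (by linarith)
  have hb : (A : ℝ) / 2 ≤ ((A - A / 2 : ℕ) : ℝ) := by
    have : A ≤ 2 * (A - A / 2) := by omega
    have : (A : ℝ) ≤ 2 * ((A - A / 2 : ℕ) : ℝ) := by exact_mod_cast this
    linarith
  have h3 : (S : ℝ) ≤ ((A - A / 2 : ℕ) : ℝ) ^ ⌊D⌋₊ :=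
    calc (S : ℝ) = S / 3 * 3 := by ring
      _ ≤ ((A : ℝ) / 2) ^ (D / 2) * ((A : ℝ) / 2) ^ (D / 2 - 1) :=
          mul_le_mul h1 h2 (by norm_num) (by positivity)
      _ = ((A : ℝ) / 2) ^ (D - 1) := by
          rw [← Real.rpow_add (by linarith)]
          congr 1
          ring
      _ ≤ ((A : ℝ) / 2) ^ ((⌊D⌋₊ : ℕ) : ℝ) :=
          Real.rpow_le_rpow_of_exponent_le (by linarith) (Nat.sub_one_lt_floor D).le
      _ = ((A : ℝ) / 2) ^ ⌊D⌋₊ := Real.rpow_natCast _ _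
      _ ≤ _ := pow_le_pow_left₀ (by positivity) hb _
  exact_mod_cast h3

end MultiTaskRL
end

theorem mainTheorem3 (S A : ℕ) (hS : 20 ≤ S) (hA : 20 ≤ A) (D : ℝ) (hD : 16 ≤ D)
    (hDlog : Real.logb ((A : ℝ) / 2) ((S : ℝ) / 3) ≤ D / 2)
    (lam : ℝ) (hlam : lam ∈ Set.Ioc (0 : ℝ) (1 / 2)) :
    ∃ (S' : ℕ) (M : Fin (S * A / 12) → MultiTaskRL.MDP (Fin S') (Fin A)),
      S' ≤ S ∧
      (∀ i j, (M i).reward = (M j).reward) ∧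
      (∀ i, (M i).diameter ≤ ENNReal.ofReal D) ∧
      MultiTaskRL.IsSeparable lam M ∧
      MultiTaskRL.IsPACIdentifiable M ∧
      ∀ (q : MultiTaskRL.Sampler (Fin S') (Fin A)) (n : ℕ)
        (C : MultiTaskRL.Classifier (Fin S') (Fin A) (S * A / 12)),
        (n : ℝ) < (S : ℝ) * (A : ℝ) / (180 * lam ^ 2) →
          ∃ i : Fin (S * A / 12),
            1 / 2 ≤ ((M i).outputLaw q n C).toOuterMeasure {j | j ≠ i} := by
  have hl : lam ∈ Set.Icc (0 : ℝ) 1 := ⟨hlam.1.le, by linarith [hlam.2]⟩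
  have hSA : 400 ≤ S * A := Nat.mul_le_mul hS hA
  have hM : 33 ≤ S * A / 12 := by omega
  have hK : S * A / 12 ≤ S * (A / 2) := by
    have h1 : S * A ≤ S * (12 * (A / 2)) := Nat.mul_le_mul_left S (by omega)
    have h2 : S * (12 * (A / 2)) = 12 * (S * (A / 2)) := by ring
    omega
  have : NeZero (S * A / 12) := ⟨by omega⟩
  have hwalk := MultiTaskRL.deBruijn_walk (S := S) (A := A) (by omega) (by omega) hK
    (MultiTaskRL.le_half_pow_floor hS hA hD hDlog)
  set E := MultiTaskRL.deBruijn S A (S * A / 12) (by omega) (by omega) hK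
  -- From here on the graph matters only through `hwalk`.
  clear_value E
  refine ⟨S, E.biased lam hl, le_rfl, fun _ _ => rfl, fun i => ?_, E.isSeparable hl,
    E.isPACIdentifiable hwalk hlam.1 hl, fun q n C hn => ?_⟩
  · refine (E.diameter_le (Nat.floor_pos.2 (by linarith)) hwalk _ _).trans ?_
    rw [← ENNReal.ofReal_natCast]
    exact ENNReal.ofReal_le_ofReal (Nat.floor_le (by linarith))
  · refine E.exists_half_le_failure hlam hl q n C ?_
    have hlam2 : 0 < lam ^ 2 := pow_pos hlam.1 2
    rw [lt_div_iff₀ (by positivity)] at hn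
    -- `hn` gives `4 / 3 * lam ^ 2 * n < S * A / 135`, and `S * A ≤ 12 * K + 11` with `K ≥ 33`
    -- leaves room below `K / 2 - 2`.
    have h1 : S * A ≤ 12 * (S * A / 12) + 11 := by omega
    have h2 : (S : ℝ) * A ≤ 12 * ((S * A / 12 : ℕ) : ℝ) + 11 := by exact_mod_cast h1
    have h3 : (33 : ℝ) ≤ ((S * A / 12 : ℕ) : ℝ) := by exact_mod_cast hM
    linarith
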